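/- Let $I,J$ be arbitrary index sets and let $(E_j)_{j\in J}$, $(K_j)_{j\in J}$, $(F_i)_{i\in I}$, $(L_i)_{i\in I}$ be families of complex Hilbert spaces, with Hilbert sums $E=\oplus_j E_j$, $K=\oplus_j K_j$, $F=\oplus_i F_i$, $L=\oplus_i L_i$; $\otimes$ denotes the Hilbert space tensor product. Let $A=(A_{ij})$, $A_{ij}\in B(E_j,F_i)$, be row bounded and $B=(B_{ij})$, $B_{ij}\in B(K_j,L_i)$, be column bounded, i.e. the norms $$\|A\|_r=\sup_{i}\Big\|\sum_{j}A_{ij}A_{ij}^*\Big\|^{1/2},\qquad \|B\|_c=\sup_{j}\Big\|\sum_{i}B_{ij}^*B_{ij}\Big\|^{1/2}$$ are finite (the sums converge strongly; these norms are the suprema over $i$, respectively $j$, and all finite partial sums). Let $\mathrm{diag}(AA^*)$ be the bounded diagonal operator on $F$ with entries $\sum_jA_{ij}A_{ij}^*$ and $\mathrm{diag}(B^*B)$ the bounded diagonal operator on $K$ with entries $\sum_iB_{ij}^*B_{ij}$. For block matrices, $X\boxtimes Y:=(X_{ij}\otimes Y_{ij})$. Put $\lambda(A)=(A_{ij}\otimes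 I_L)$ and $\rho(B)=(I_E\otimes B_{ij})$, and let $v:\oplus_j(E_j\otimes K_j)\to E\otimes K$ and $w:\oplus_i(F_i\otimes L_i)\to F\otimes L$ be the natural isometric embeddings onto the closed linear spans of the pairwise orthogonal subspaces $E_j\otimes K_j$, respectively $F_i\otimes L_i$. Then $w^*\lambda(A)$ is the matrix of a bounded operator $E\otimes L\to\oplus_i(F_i\otimes L_i)$ (with respect to $E\otimes L=\oplus_j(E_j\otimes L)$), $\rho(B)v$ is the matrix of a bounded operator $\oplus_j(E_j\otimes K_j)\to E\otimes L$ (with respect to $E\otimes L=\oplus_i(E\otimes L_i)$), $A\boxtimes B$ is the matrix of the bounded operator $\big(w^*\lambda(A)\big)\big(\rho(B)v\big)$, and, identifying bounded operators with their matrices: (i) $\|A\boxtimes B\|\le\|A\|_r\,\|B\|_c$. (ii) The matrices $\mathrm{diag}(AA^*)^{1/2}\boxtimes I_L$ and $I_E\boxtimes\mathrm{diag}(B^*B)^{1/2}$ are matrices of bounded operators on $\oplus_i(F_i\otimes L_i)$ and $\oplus_j(E_j\otimes K_j)$ respectively, and for all $\Xi\in\oplus_j(E_j\otimes K_j)$ and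 $\Gamma\in\oplus_i(F_i\otimes L_i)$ $$\begin{aligned}|\langle(A\boxtimes B)\Xi,\Gamma\rangle|&\le\big\|\big(\mathrm{diag}(AA^*)^{1/2}\boxtimes I_L\big)\Gamma\big\|\;\big\|\big(I_E\boxtimes\mathrm{diag}(B^*B)^{1/2}\big)\Xi\big\|\\&=\big\|\big(\mathrm{diag}(AA^*)^{1/2}\otimes I_L\big)w\Gamma\big\|\;\big\|\big(I_E\otimes\mathrm{diag}(B^*B)^{1/2}\big)v\Xi\big\|.\end{aligned}$$ -/

import Mathlib

open scoped TensorProduct InnerProductSpace ENNReal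

namespace BlockSchur

noncomputable section

/-! ### Hilbert space tensor products -/

/-- The Hilbert space tensor product `X ⊗ Y`: the completion of the algebraic tensor product for
the inner product `⟪x ⊗ y, x' ⊗ y'⟫ = ⟪x, x'⟫ * ⟪y, y'⟫`. -/
def HT (X Y : Type*) [NormedAddCommGroup X] [InnerProductSpace ℂ X]
    [NormedAddCommGroup Y] [InnerProductSpace ℂ Y] : Type _ :=
  UniformSpace.Completion (X ⊗[ℂ] Y)

section Tensor

variable {X X' X'' Y Y' Y'' : Type*}
  [NormedAddCommGroup X] [InnerProductSpace ℂ X] [NormedAddCommGroup X'] [InnerProductSpace ℂ X']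
  [NormedAddCommGroup X''] [InnerProductSpace ℂ X'']
  [NormedAddCommGroup Y] [InnerProductSpace ℂ Y] [NormedAddCommGroup Y'] [InnerProductSpace ℂ Y']
  [NormedAddCommGroup Y''] [InnerProductSpace ℂ Y'']

instance : NormedAddCommGroup (HT X Y) :=
  inferInstanceAs (NormedAddCommGroup (UniformSpace.Completion (X ⊗[ℂ] Y)))

instance : InnerProductSpace ℂ (HT X Y) :=
  inferInstanceAs (InnerProductSpace ℂ (UniformSpace.Completion (X ⊗[ℂ] Y)))

instance : CompleteSpace (HT X Y) :=
  inferInstanceAs (CompleteSpace (UniformSpace.Completion (X ⊗[ℂ] Y)))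

/-- The embedding of the algebraic tensor product. -/
def HT.of : X ⊗[ℂ] Y →ₗᵢ[ℂ] HT X Y :=
  (UniformSpace.Completion.toComplₗᵢ : X ⊗[ℂ] Y →ₗᵢ[ℂ] UniformSpace.Completion (X ⊗[ℂ] Y))

theorem HT.denseRange_of : DenseRange (HT.of : X ⊗[ℂ] Y →ₗᵢ[ℂ] HT X Y) :=
  UniformSpace.Completion.denseRange_coe (α := X ⊗[ℂ] Y)

/-- The bounded operator `S ⊗ T` on Hilbert space tensor products, `x ⊗ y ↦ S x ⊗ T y`. -/
def tmap (S : X →L[ℂ] X') (T : Y →L[ℂ] Y') : HT X Y →L[ℂ] HT X' Y' :=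
  ((TensorProduct.mapL S T).completion :
    UniformSpace.Completion (X ⊗[ℂ] Y) →L[ℂ] UniformSpace.Completion (X' ⊗[ℂ] Y'))

theorem tmap_of (S : X →L[ℂ] X') (T : Y →L[ℂ] Y') (z : X ⊗[ℂ] Y) :
    tmap S T (HT.of z) = HT.of (TensorProduct.map S.toLinearMap T.toLinearMap z) :=
  (ContinuousLinearMap.completion_apply_coe (TensorProduct.mapL S T) z).trans
    (congrArg (fun w => (HT.of w : HT X' Y')) (by simp))

theorem tmap_tmul (S : X →L[ℂ] X') (T : Y →L[ℂ] Y') (x : X) (y : Y) :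
    tmap S T (HT.of (x ⊗ₜ[ℂ] y)) = HT.of (S x ⊗ₜ[ℂ] T y) := by
  rw [tmap_of]; rfl

/-- Bounded operators on a Hilbert space tensor product are determined on elementary tensors. -/
theorem ht_ext {Z : Type*} [NormedAddCommGroup Z] [NormedSpace ℂ Z] {S T : HT X Y →L[ℂ] Z}
    (h : ∀ x y, S (HT.of (x ⊗ₜ[ℂ] y)) = T (HT.of (x ⊗ₜ[ℂ] y))) : S = T := by
  ext z
  induction z using HT.denseRange_of.induction_on with
  | hp => exact isClosed_eq S.continuous T.continuous
  | ih z =>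
    induction z using TensorProduct.induction_on with
    | zero => simp
    | tmul x y => exact h x y
    | add a b ha hb => simp only [map_add, ha, hb]

theorem tmap_comp (S' : X' →L[ℂ] X'') (S : X →L[ℂ] X') (T' : Y' →L[ℂ] Y'') (T : Y →L[ℂ] Y') :
    tmap S' T' ∘L tmap S T = tmap (S' ∘L S) (T' ∘L T) :=
  ht_ext fun x y => by simp [tmap_tmul]

theorem tmap_zero_left (T : Y →L[ℂ] Y') : tmap (0 : X →L[ℂ] X') T = 0 :=
  ht_ext fun x y => by simp [tmap_tmul]

theorem tmap_zero_right (S : X →L[ℂ] X') : tmap S (0 : Y →L[ℂ] Y') = 0 :=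
  ht_ext fun x y => by simp [tmap_tmul]

theorem HT.inner_of (x x' : X) (y y' : Y) :
    ⟪(HT.of (x ⊗ₜ[ℂ] y) : HT X Y), HT.of (x' ⊗ₜ[ℂ] y')⟫_ℂ = ⟪x, x'⟫_ℂ * ⟪y, y'⟫_ℂ := by
  rw [LinearIsometry.inner_map_map, TensorProduct.inner_tmul]

theorem tmap_adjoint [CompleteSpace X] [CompleteSpace X'] [CompleteSpace Y] [CompleteSpace Y']
    (S : X →L[ℂ] X') (T : Y →L[ℂ] Y') : (tmap S T).adjoint = tmap S.adjoint T.adjoint := by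
  refine ht_ext fun x y => ext_inner_right ℂ fun z => ?_
  rw [ContinuousLinearMap.adjoint_inner_left]
  have : (innerSL ℂ (HT.of (x ⊗ₜ[ℂ] y))) ∘L tmap S T
      = innerSL ℂ (tmap S.adjoint T.adjoint (HT.of (x ⊗ₜ[ℂ] y))) :=
    ht_ext fun x' y' => by
      simp [tmap_tmul, ContinuousLinearMap.adjoint_inner_left]
  exact congrArg (fun f => f z) this

/-- The isometry `S ⊗ T` for isometries `S` and `T`. -/
def tmapIso (S : X →ₗᵢ[ℂ] X') (T : Y →ₗᵢ[ℂ] Y') : HT X Y →ₗᵢ[ℂ] HT X' Y' where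
  toLinearMap := (tmap S.toContinuousLinearMap T.toContinuousLinearMap).toLinearMap
  norm_map' z := by
    induction z using HT.denseRange_of.induction_on with
    | hp =>
      exact isClosed_eq
        ((tmap S.toContinuousLinearMap T.toContinuousLinearMap).continuous.norm) continuous_norm
    | ih z =>
      change ‖tmap S.toContinuousLinearMap T.toContinuousLinearMap (HT.of z)‖ = _
      rw [tmap_of, LinearIsometry.norm_map, LinearIsometry.norm_map]
      exact TensorProduct.norm_map S T z

theorem tmapIso_toCLM (S : X →ₗᵢ[ℂ] X') (T : Y →ₗᵢ[ℂ] Y') :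
    (tmapIso S T).toContinuousLinearMap
      = tmap S.toContinuousLinearMap T.toContinuousLinearMap := rfl

end Tensor

/-! ### Hilbert sums and block matrices -/

section Sum

variable {ι : Type*} (X Y : ι → Type*)
  [∀ i, NormedAddCommGroup (X i)] [∀ i, InnerProductSpace ℂ (X i)]
  [∀ i, NormedAddCommGroup (Y i)] [∀ i, InnerProductSpace ℂ (Y i)]

/-- The Hilbert sum `⊕ᵢ Xᵢ`, the space of square summable families `(xᵢ)`. -/
def HSum : Type _ := lp X 2

instance : NormedAddCommGroup (HSum X) := inferInstanceAs (NormedAddCommGroup (lp X 2))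

instance : InnerProductSpace ℂ (HSum X) := inferInstanceAs (InnerProductSpace ℂ (lp X 2))

instance [∀ i, CompleteSpace (X i)] : CompleteSpace (HSum X) :=
  inferInstanceAs (CompleteSpace (lp X 2))

open Classical in
/-- The embedding of the `i`th summand in `⊕ᵢ Xᵢ`. Its adjoint is the orthogonal projection onto
this summand, with values in `Xᵢ`. -/
def incl (i : ι) : X i →ₗᵢ[ℂ] HSum X :=
  ({ toLinearMap := lp.lsingle (𝕜 := ℂ) 2 i
     norm_map' := fun x => lp.norm_single (by norm_num) i x } : X i →ₗᵢ[ℂ] lp X 2)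

/-- The embedding of `Xᵢ ⊗ H` in `(⊕ᵢ Xᵢ) ⊗ H`. -/
def inclTensor (H : Type*) [NormedAddCommGroup H] [InnerProductSpace ℂ H] (i : ι) :
    HT (X i) H →ₗᵢ[ℂ] HT (HSum X) H :=
  tmapIso (incl X i) LinearIsometry.id

/-- The embedding of `H ⊗ Xᵢ` in `H ⊗ (⊕ᵢ Xᵢ)`. -/
def tensorIncl (H : Type*) [NormedAddCommGroup H] [InnerProductSpace ℂ H] (i : ι) :
    HT H (X i) →ₗᵢ[ℂ] HT H (HSum X) :=
  tmapIso LinearIsometry.id (incl X i)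

/-- The closed linear span of the pairwise orthogonal subspaces `Xᵢ ⊗ Yᵢ` of
`(⊕ᵢ Xᵢ) ⊗ (⊕ᵢ Yᵢ)`. -/
def diagSub : Submodule ℂ (HT (HSum X) (HSum Y)) :=
  (⨆ i, LinearMap.range (tmapIso (incl X i) (incl Y i)).toLinearMap).topologicalClosure

/-- The Hilbert space `⊕ᵢ (Xᵢ ⊗ Yᵢ)`, realized as the closed linear span of the pairwise orthogonal
subspaces `Xᵢ ⊗ Yᵢ` of `(⊕ᵢ Xᵢ) ⊗ (⊕ᵢ Yᵢ)`; see `isHilbertSum_diagIncl`. -/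
def DSum : Type _ := diagSub X Y

instance : NormedAddCommGroup (DSum X Y) := inferInstanceAs (NormedAddCommGroup (diagSub X Y))

instance : InnerProductSpace ℂ (DSum X Y) := inferInstanceAs (InnerProductSpace ℂ (diagSub X Y))

instance : CompleteSpace (DSum X Y) :=
  inferInstanceAs (CompleteSpace
    (⨆ i, LinearMap.range (tmapIso (incl X i) (incl Y i)).toLinearMap).topologicalClosure)

/-- The natural isometric embedding of `⊕ᵢ (Xᵢ ⊗ Yᵢ)` in `(⊕ᵢ Xᵢ) ⊗ (⊕ᵢ Yᵢ)`. -/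
def diagEmb : DSum X Y →ₗᵢ[ℂ] HT (HSum X) (HSum Y) := (diagSub X Y).subtypeₗᵢ

/-- The embedding of `Xᵢ ⊗ Yᵢ` in `⊕ᵢ (Xᵢ ⊗ Yᵢ)`. -/
def diagIncl (i : ι) : HT (X i) (Y i) →ₗᵢ[ℂ] DSum X Y :=
  ({ toLinearMap := (tmapIso (incl X i) (incl Y i)).toLinearMap.codRestrict (diagSub X Y) fun z =>
       Submodule.le_topologicalClosure _
        (Submodule.mem_iSup_of_mem i (LinearMap.mem_range_self _ z))
     norm_map' := fun z => (tmapIso (incl X i) (incl Y i)).norm_map z } :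
    HT (X i) (Y i) →ₗᵢ[ℂ] diagSub X Y)

theorem diagEmb_diagIncl (i : ι) (z : HT (X i) (Y i)) :
    diagEmb X Y (diagIncl X Y i z) = tmapIso (incl X i) (incl Y i) z := rfl

end Sum

/-- `Mat E F` is the set of all matrices `(Aᵢⱼ)` with entries `Aᵢⱼ ∈ B(Eⱼ, Fᵢ)`. -/
abbrev Mat {I J : Type*} (E : J → Type*) (F : I → Type*)
    [∀ j, NormedAddCommGroup (E j)] [∀ j, InnerProductSpace ℂ (E j)]
    [∀ i, NormedAddCommGroup (F i)] [∀ i, InnerProductSpace ℂ (F i)] : Type _ :=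
  ∀ i j, E j →L[ℂ] F i

section Matrix

variable {I J : Type*} {E : J → Type*} {F : I → Type*}
  [∀ j, NormedAddCommGroup (E j)] [∀ j, InnerProductSpace ℂ (E j)]
  [∀ i, NormedAddCommGroup (F i)] [∀ i, InnerProductSpace ℂ (F i)] [∀ i, CompleteSpace (F i)]
  {X Y : Type*} [NormedAddCommGroup X] [InnerProductSpace ℂ X] [CompleteSpace X]
  [NormedAddCommGroup Y] [InnerProductSpace ℂ Y] [CompleteSpace Y]

/-- The block matrix of a bounded operator `T : X → Y` relative to decompositions of `X` and `Y`
given by families of isometries `Uⱼ : Eⱼ → X` and `Vᵢ : Fᵢ → Y`. -/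
def blocks (U : ∀ j, E j →ₗᵢ[ℂ] X) (V : ∀ i, F i →ₗᵢ[ℂ] Y) (T : X →L[ℂ] Y) : Mat E F :=
  fun i j => (V i).toContinuousLinearMap.adjoint ∘L T ∘L (U j).toContinuousLinearMap

/-- `M` is the block matrix of the bounded operator `T`. -/
def IsMatrixOf (U : ∀ j, E j →ₗᵢ[ℂ] X) (V : ∀ i, F i →ₗᵢ[ℂ] Y) (M : Mat E F) (T : X →L[ℂ] Y) :
    Prop :=
  blocks U V T = M

open Classical in
/-- The bounded operator with block matrix `M`. It is unique when `X` and `Y` are the Hilbert sums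
of the given families, see `isMatrixOf_unique`. The value is `0` if there is none. -/
def opOf (U : ∀ j, E j →ₗᵢ[ℂ] X) (V : ∀ i, F i →ₗᵢ[ℂ] Y) (M : Mat E F) : X →L[ℂ] Y :=
  if h : ∃ T, IsMatrixOf U V M T then h.choose else 0

theorem isMatrixOf_unique {U : ∀ j, E j →ₗᵢ[ℂ] X} {V : ∀ i, F i →ₗᵢ[ℂ] Y}
    (hU : IsHilbertSum ℂ E U) (hV : IsHilbertSum ℂ F V) {M : Mat E F} {S T : X →L[ℂ] Y}
    (hS : IsMatrixOf U V M S) (hT : IsMatrixOf U V M T) : S = T := by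
  have key : ∀ j (x : E j), S (U j x) = T (U j x) := by
    intro j x
    rw [← sub_eq_zero]
    set y := S (U j x) - T (U j x) with hy
    have h0 : ∀ i (z : F i), ⟪V i z, y⟫_ℂ = 0 := by
      intro i z
      have h1 : blocks U V S i j x = blocks U V T i j x := by
        rw [show blocks U V S = blocks U V T from hS.trans hT.symm]
      have h2 : (V i).toContinuousLinearMap.adjoint y = 0 := by
        rw [hy, map_sub, sub_eq_zero]; exact h1
      have := ContinuousLinearMap.adjoint_inner_right (V i).toContinuousLinearMap z y
      rw [h2, inner_zero_right] at this
      exact this.symm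
    obtain ⟨f, hf⟩ := hV.surjective_isometry y
    have h3 : ⟪y, y⟫_ℂ = 0 := by
      have := (hV.OrthogonalFamily.hasSum_linearIsometry f).mapL (innerSL ℂ y)
      rw [hf] at this
      refine this.unique ?_
      convert! hasSum_zero using 2 with i
      rw [innerSL_apply_apply, ← inner_conj_symm, h0, map_zero]
    exact inner_self_eq_zero.mp h3
  ext x
  obtain ⟨f, rfl⟩ := hU.surjective_isometry x
  have hs := hU.OrthogonalFamily.hasSum_linearIsometry f
  refine (hs.mapL S).unique ?_
  convert! hs.mapL T using 2 with j
  exact key j (f j)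

end Matrix

/-! ### The decompositions in use are Hilbert sums -/

section Decomp

variable {ι : Type*} (X Y : ι → Type*)
  [∀ i, NormedAddCommGroup (X i)] [∀ i, InnerProductSpace ℂ (X i)] [∀ i, CompleteSpace (X i)]
  [∀ i, NormedAddCommGroup (Y i)] [∀ i, InnerProductSpace ℂ (Y i)] [∀ i, CompleteSpace (Y i)]
  (H : Type*) [NormedAddCommGroup H] [InnerProductSpace ℂ H] [CompleteSpace H]

/-- The orthogonal projection onto the `i`th summand is the `i`th coordinate. -/
theorem incl_adjoint (i : ι) (f : HSum X) :
    (incl X i).toContinuousLinearMap.adjoint f = (show lp X 2 from f) i := by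
  classical
  refine ext_inner_left ℂ fun x => ?_
  rw [ContinuousLinearMap.adjoint_inner_right]
  have := lp.inner_single_left (𝕜 := ℂ) i x (show lp X 2 from f)
  convert! this

theorem hasSum_incl (f : HSum X) :
    HasSum (fun i => incl X i ((incl X i).toContinuousLinearMap.adjoint f)) f := by
  classical
  have h := lp.hasSum_single (p := 2) (by norm_num) (show lp X 2 from f)
  have e : (fun i => incl X i ((incl X i).toContinuousLinearMap.adjoint f))
      = fun i => (show HSum X from lp.single 2 i ((show lp X 2 from f) i)) := by
    funext i
    rw [incl_adjoint]
    change lp.single 2 i _ = lp.single 2 i _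
    congr!
  rw [e]
  exact h

theorem incl_adjoint_incl_self (i : ι) :
    (incl X i).toContinuousLinearMap.adjoint ∘L (incl X i).toContinuousLinearMap
      = ContinuousLinearMap.id ℂ (X i) := by
  classical
  ext x
  rw [ContinuousLinearMap.comp_apply, incl_adjoint]
  exact lp.single_apply_self 2 i x

theorem incl_adjoint_incl_ne {i k : ι} (h : i ≠ k) :
    (incl X i).toContinuousLinearMap.adjoint ∘L (incl X k).toContinuousLinearMap = 0 := by
  classical
  ext x
  rw [ContinuousLinearMap.comp_apply, incl_adjoint]
  exact lp.single_apply_ne 2 k x h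

theorem orthogonalFamily_of_adjoint {V : Type*} [NormedAddCommGroup V] [InnerProductSpace ℂ V]
    [CompleteSpace V] (U : ∀ i, X i →ₗᵢ[ℂ] V)
    (h : ∀ i k, i ≠ k →
      (U i).toContinuousLinearMap.adjoint ∘L (U k).toContinuousLinearMap = 0) :
    OrthogonalFamily ℂ X U := by
  intro i k hik x y
  have h1 := ContinuousLinearMap.adjoint_inner_right (U i).toContinuousLinearMap x (U k y)
  have h2 : (U i).toContinuousLinearMap.adjoint (U k y) = 0 :=
    congrArg (fun f => f y) (h i k hik)
  rw [h2, inner_zero_right] at h1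
  exact h1.symm

/-- A closed subspace of a Hilbert space tensor product which contains all elementary tensors is
the whole space. -/
theorem ht_eq_top {V W : Type*} [NormedAddCommGroup V] [InnerProductSpace ℂ V]
    [NormedAddCommGroup W] [InnerProductSpace ℂ W] (S : Submodule ℂ (HT V W))
    (hS : IsClosed (S : Set (HT V W))) (h : ∀ x y, HT.of (x ⊗ₜ[ℂ] y) ∈ S) : ⊤ ≤ S := by
  suffices h' : ∀ z, z ∈ S from fun z _ => h' z
  intro z
  induction z using HT.denseRange_of.induction_on with
  | hp => exact hS
  | ih z =>
    induction z using TensorProduct.induction_on with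
    | zero => simp
    | tmul x y => exact h x y
    | add a b ha hb => rw [map_add]; exact S.add_mem ha hb

theorem isHilbertSum_incl : IsHilbertSum ℂ X (incl X) := by
  refine IsHilbertSum.mk
    (orthogonalFamily_of_adjoint X _ fun i k h => incl_adjoint_incl_ne X h) fun f _ => ?_
  refine mem_closure_of_tendsto (hasSum_incl X f) (Filter.Eventually.of_forall fun s => ?_)
  exact Submodule.sum_mem _ fun i _ =>
    Submodule.mem_iSup_of_mem i (LinearMap.mem_range_self _ _)

theorem isHilbertSum_inclTensor :
    IsHilbertSum ℂ (fun i => HT (X i) H) (inclTensor X H) := by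
  refine IsHilbertSum.mk (orthogonalFamily_of_adjoint _ _ fun i k h => ?_)
    (ht_eq_top _ (Submodule.isClosed_topologicalClosure _) fun f h => ?_)
  · rw [inclTensor, inclTensor, tmapIso_toCLM, tmapIso_toCLM, tmap_adjoint, tmap_comp,
      incl_adjoint_incl_ne X h, tmap_zero_left]
  · have hs := (hasSum_incl X f).mapL
      ((HT.of (X := HSum X) (Y := H)).toContinuousLinearMap
        ∘L (TensorProduct.mkL ℂ (HSum X) H).flip h)
    refine mem_closure_of_tendsto hs (Filter.Eventually.of_forall fun s => ?_)
    refine Submodule.sum_mem _ fun i _ => Submodule.mem_iSup_of_mem i ?_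
    exact ⟨HT.of ((incl X i).toContinuousLinearMap.adjoint f ⊗ₜ[ℂ] h), tmap_tmul _ _ _ _⟩

theorem isHilbertSum_tensorIncl :
    IsHilbertSum ℂ (fun i => HT H (X i)) (tensorIncl X H) := by
  refine IsHilbertSum.mk (orthogonalFamily_of_adjoint _ _ fun i k h => ?_)
    (ht_eq_top _ (Submodule.isClosed_topologicalClosure _) fun h f => ?_)
  · rw [tensorIncl, tensorIncl, tmapIso_toCLM, tmapIso_toCLM, tmap_adjoint, tmap_comp,
      incl_adjoint_incl_ne X h, tmap_zero_right]
  · have hs := (hasSum_incl X f).mapL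
      ((HT.of (X := H) (Y := HSum X)).toContinuousLinearMap
        ∘L TensorProduct.mkL ℂ H (HSum X) h)
    refine mem_closure_of_tendsto hs (Filter.Eventually.of_forall fun s => ?_)
    refine Submodule.sum_mem _ fun i _ => Submodule.mem_iSup_of_mem i ?_
    exact ⟨HT.of (h ⊗ₜ[ℂ] (incl X i).toContinuousLinearMap.adjoint f), tmap_tmul _ _ _ _⟩

theorem isHilbertSum_diagIncl :
    IsHilbertSum ℂ (fun i => HT (X i) (Y i)) (diagIncl X Y) := by
  have ho : OrthogonalFamily ℂ (fun i => HT (X i) (Y i)) fun i => tmapIso (incl X i) (incl Y i) :=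
    orthogonalFamily_of_adjoint _ _ fun i k h => by
      rw [tmapIso_toCLM, tmapIso_toCLM, tmap_adjoint, tmap_comp, incl_adjoint_incl_ne X h,
        tmap_zero_left]
  have ho' : OrthogonalFamily ℂ (fun i => HT (X i) (Y i)) (diagIncl X Y) :=
    fun i k h x y => ho h x y
  refine ⟨ho', fun z => ?_⟩
  have hz : diagEmb X Y z ∈ diagSub X Y := z.2
  rw [diagSub, ← ho.range_linearIsometry] at hz
  obtain ⟨f, hf⟩ := hz
  refine ⟨f, (diagEmb X Y).injective ?_⟩
  have h1 := (ho'.hasSum_linearIsometry f).mapL (diagEmb X Y).toContinuousLinearMap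
  exact (h1.unique (ho.hasSum_linearIsometry f)).trans hf

theorem wStar_block_eq_zero {i k : ι} (h : i ≠ k) :
    blocks (inclTensor X (HSum Y)) (diagIncl X Y)
      (diagEmb X Y).toContinuousLinearMap.adjoint i k = 0 := by
  have e : (diagEmb X Y).toContinuousLinearMap ∘L (diagIncl X Y i).toContinuousLinearMap
      = tmap (incl X i).toContinuousLinearMap (incl Y i).toContinuousLinearMap := rfl
  rw [blocks, ← ContinuousLinearMap.comp_assoc, ← ContinuousLinearMap.adjoint_comp, e,
    inclTensor, tmapIso_toCLM, tmap_adjoint, tmap_comp, incl_adjoint_incl_ne X h, tmap_zero_left]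

theorem v_block_eq_zero {k j : ι} (h : k ≠ j) :
    blocks (diagIncl X Y) (tensorIncl Y (HSum X)) (diagEmb X Y).toContinuousLinearMap k j = 0 := by
  have e : (diagEmb X Y).toContinuousLinearMap ∘L (diagIncl X Y j).toContinuousLinearMap
      = tmap (incl X j).toContinuousLinearMap (incl Y j).toContinuousLinearMap := rfl
  rw [blocks, e, tensorIncl, tmapIso_toCLM, tmap_adjoint, tmap_comp, incl_adjoint_incl_ne Y h,
    tmap_zero_right]

end Decomp

/-! ### Row and column norms and diagonals -/

section Norms

variable {I J : Type*} {E K : J → Type*} {F L : I → Type*}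
  [∀ j, NormedAddCommGroup (E j)] [∀ j, InnerProductSpace ℂ (E j)] [∀ j, CompleteSpace (E j)]
  [∀ i, NormedAddCommGroup (F i)] [∀ i, InnerProductSpace ℂ (F i)] [∀ i, CompleteSpace (F i)]
  [∀ j, NormedAddCommGroup (K j)] [∀ j, InnerProductSpace ℂ (K j)] [∀ j, CompleteSpace (K j)]
  [∀ i, NormedAddCommGroup (L i)] [∀ i, InnerProductSpace ℂ (L i)] [∀ i, CompleteSpace (L i)]

/-- The norm of a finite partial sum of `∑ⱼ Aᵢⱼ Aᵢⱼ*` in the `i`th row. -/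
def rowPart (A : Mat E F) (p : I × Finset J) : ℝ :=
  ‖∑ j ∈ p.2, A p.1 j ∘L (A p.1 j).adjoint‖

/-- The norm of a finite partial sum of `∑ᵢ Bᵢⱼ* Bᵢⱼ` in the `j`th column. -/
def colPart (B : Mat K L) (p : J × Finset I) : ℝ :=
  ‖∑ i ∈ p.2, (B i p.1).adjoint ∘L B i p.1‖

/-- `A` is row bounded. -/
def RowBounded (A : Mat E F) : Prop := BddAbove (Set.range (rowPart A))

/-- `B` is column bounded. -/
def ColBounded (B : Mat K L) : Prop := BddAbove (Set.range (colPart B))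

/-- The row norm `‖A‖_r = supᵢ ‖∑ⱼ Aᵢⱼ Aᵢⱼ*‖ ^ (1/2)`; the norm of the (strong) sum of positive
operators is the supremum of the norms of the finite partial sums. -/
def rowNorm (A : Mat E F) : ℝ := √(⨆ p, rowPart A p)

/-- The column norm `‖B‖_c = supⱼ ‖∑ᵢ Bᵢⱼ* Bᵢⱼ‖ ^ (1/2)`. -/
def colNorm (B : Mat K L) : ℝ := √(⨆ p, colPart B p)

/-- The adjoint matrix `A*`. -/
def adjMat (A : Mat E F) : Mat F E := fun j i => (A i j).adjoint

theorem RowBounded.colBounded_adjMat {A : Mat E F} (hA : RowBounded A) : ColBounded (adjMat A) := by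
  have : colPart (adjMat A) = rowPart A := by
    ext p
    simp [colPart, rowPart, adjMat]
  rw [ColBounded, this]
  exact hA

theorem ColBounded.sum_le {B : Mat K L} (hB : ColBounded B) (j : J) (x : K j) (s : Finset I) :
    ∑ i ∈ s, ‖B i j x‖ ^ 2 ≤ (colNorm B * ‖x‖) ^ 2 := by
  have h0 : 0 ≤ ⨆ p, colPart B p := Real.iSup_nonneg fun p => norm_nonneg _
  have h1 : colPart B (j, s) ≤ ⨆ p, colPart B p := le_ciSup hB (j, s)
  have h2 : ∑ i ∈ s, ‖B i j x‖ ^ 2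
      = RCLike.re ⟪(∑ i ∈ s, (B i j).adjoint ∘L B i j) x, x⟫_ℂ := by
    rw [sum_apply, sum_inner, map_sum]
    refine Finset.sum_congr rfl fun i _ => ?_
    rw [ContinuousLinearMap.comp_apply, ContinuousLinearMap.adjoint_inner_left,
      inner_self_eq_norm_sq]
  rw [h2, mul_pow, colNorm, Real.sq_sqrt h0]
  calc _ ≤ ‖(∑ i ∈ s, (B i j).adjoint ∘L B i j) x‖ * ‖x‖ := re_inner_le_norm _ _
    _ ≤ (colPart B (j, s) * ‖x‖) * ‖x‖ := by
        gcongr; exact ContinuousLinearMap.le_opNorm _ _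
    _ ≤ ((⨆ p, colPart B p) * ‖x‖) * ‖x‖ := by gcongr
    _ = _ := by ring

/-- The `j`th column of a column bounded matrix, as the bounded operator
`x ↦ (Bᵢⱼ x)ᵢ` from `Kⱼ` to `⊕ᵢ Lᵢ`. -/
def colOp (B : Mat K L) (hB : ColBounded B) (j : J) : K j →L[ℂ] HSum L :=
  (LinearMap.mkContinuous
    { toFun := fun x => ⟨fun i => B i j x, memℓp_gen' (C := (colNorm B * ‖x‖) ^ 2) fun s => by
        simpa using hB.sum_le j x s⟩
      map_add' := fun _ _ => lp.ext (funext fun _ => map_add _ _ _)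
      map_smul' := fun _ _ => lp.ext (funext fun _ => map_smul _ _ _) }
    (colNorm B) (fun x =>
      lp.norm_le_of_forall_sum_le (by norm_num) (mul_nonneg (Real.sqrt_nonneg _) (norm_nonneg _))
        fun s => by
          have := hB.sum_le j x s
          have h2 : ∑ i ∈ s, ‖B i j x‖ ^ (2 : ℝ≥0∞).toReal
              ≤ (colNorm B * ‖x‖) ^ (2 : ℝ≥0∞).toReal := by
            simpa only [ENNReal.toReal_ofNat, Real.rpow_ofNat] using this
          exact h2) : K j →L[ℂ] lp L 2)

theorem norm_colOp_le (B : Mat K L) (hB : ColBounded B) (j : J) : ‖colOp B hB j‖ ≤ colNorm B :=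
  LinearMap.mkContinuous_norm_le _ (Real.sqrt_nonneg _) _

theorem incl_adjoint_colOp (B : Mat K L) (hB : ColBounded B) (j : J) (i : I) :
    (incl L i).toContinuousLinearMap.adjoint ∘L colOp B hB j = B i j := by
  ext x
  rw [ContinuousLinearMap.comp_apply, incl_adjoint]
  rfl

/-- The diagonal entry `(B*B)ⱼⱼ`; it is the strongly convergent sum `∑ᵢ Bᵢⱼ* Bᵢⱼ`, see
`hasSum_colDiag`. -/
def colDiag (B : Mat K L) (hB : ColBounded B) (j : J) : K j →L[ℂ] K j :=
  (colOp B hB j).adjoint ∘L colOp B hB j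

theorem hasSum_colDiag (B : Mat K L) (hB : ColBounded B) (j : J) (x : K j) :
    HasSum (fun i => (B i j).adjoint (B i j x)) (colDiag B hB j x) := by
  have h := (hasSum_incl L (colOp B hB j x)).mapL (colOp B hB j).adjoint
  convert! h using 2 with i
  rw [← incl_adjoint_colOp B hB j i, ContinuousLinearMap.adjoint_comp,
    ContinuousLinearMap.adjoint_adjoint]
  rfl

theorem norm_colDiag_le (B : Mat K L) (hB : ColBounded B) (j : J) :
    ‖colDiag B hB j‖ ≤ colNorm B ^ 2 := by
  refine (ContinuousLinearMap.opNorm_comp_le _ _).trans ?_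
  rw [LinearIsometryEquiv.norm_map, ← sq]
  exact pow_le_pow_left₀ (norm_nonneg _) (norm_colOp_le B hB j) 2

/-- The bounded diagonal operator `diag(B*B)` on `⊕ⱼ Kⱼ`. -/
def diagColOp (B : Mat K L) (hB : ColBounded B) : HSum K →L[ℂ] HSum K :=
  (lp.mapCLM 2 (colDiag B hB) (sq_nonneg (colNorm B)) (norm_colDiag_le B hB) :
    lp K 2 →L[ℂ] lp K 2)

/-- The bounded diagonal operator `diag(AA*)` on `⊕ᵢ Fᵢ`, with entries `∑ⱼ Aᵢⱼ Aᵢⱼ*`. -/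
def diagRowOp (A : Mat E F) (hA : RowBounded A) : HSum F →L[ℂ] HSum F :=
  diagColOp (adjMat A) hA.colBounded_adjMat

/-! ### The block Schur tensor product -/

/-- The block Schur tensor product `A ⊠ B = (Aᵢⱼ ⊗ Bᵢⱼ)`. -/
def boxtimes (A : Mat E F) (B : Mat K L) :
    Mat (fun j => HT (E j) (K j)) (fun i => HT (F i) (L i)) :=
  fun i j => tmap (A i j) (B i j)

/-- `λ(A) = (Aᵢⱼ ⊗ I_H)`. -/
def lam (H : Type*) [NormedAddCommGroup H] [InnerProductSpace ℂ H] (A : Mat E F) :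
    Mat (fun j => HT (E j) H) (fun i => HT (F i) H) :=
  fun i j => tmap (A i j) (ContinuousLinearMap.id ℂ H)

/-- `ρ(B) = (I_H ⊗ Bᵢⱼ)`. -/
def rho (H : Type*) [NormedAddCommGroup H] [InnerProductSpace ℂ H] (B : Mat K L) :
    Mat (fun j => HT H (K j)) (fun i => HT H (L i)) :=
  fun i j => tmap (ContinuousLinearMap.id ℂ H) (B i j)

variable (L) in
/-- The matrix of `w* λ(A)`, where `w : ⊕ᵢ (Fᵢ ⊗ Lᵢ) → F ⊗ L` is the embedding and
`F ⊗ L = ⊕ₖ (Fₖ ⊗ L)`. The block `(w*)ᵢₖ` is `0` for `k ≠ i` (see `wStar_block_eq_zero`), hence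
the entry `∑ₖ (w*)ᵢₖ λ(A)ₖⱼ` is `(w*)ᵢᵢ λ(A)ᵢⱼ`. -/
def wStarLamMat (A : Mat E F) : Mat (fun j => HT (E j) (HSum L)) (fun i => HT (F i) (L i)) :=
  fun i j => blocks (inclTensor F (HSum L)) (diagIncl F L) (diagEmb F L).toContinuousLinearMap.adjoint i i
    ∘L lam (HSum L) A i j

variable (E) in
/-- The matrix of `ρ(B) v`, where `v : ⊕ⱼ (Eⱼ ⊗ Kⱼ) → E ⊗ K` is the embedding and
`E ⊗ K = ⊕ₖ (E ⊗ Kₖ)`. The block `vₖⱼ` is `0` for `k ≠ j` (see `v_block_eq_zero`), hence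
the entry `∑ₖ ρ(B)ᵢₖ vₖⱼ` is `ρ(B)ᵢⱼ vⱼⱼ`. -/
def rhoVMat (B : Mat K L) : Mat (fun j => HT (E j) (K j)) (fun i => HT (HSum E) (L i)) :=
  fun i j => rho (HSum E) B i j
    ∘L blocks (diagIncl E K) (tensorIncl K (HSum E)) (diagEmb E K).toContinuousLinearMap j j

variable (L) in
/-- The bounded operator `w* λ(A) : E ⊗ L → ⊕ᵢ (Fᵢ ⊗ Lᵢ)`. -/
def wStarLam (A : Mat E F) : HT (HSum E) (HSum L) →L[ℂ] DSum F L :=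
  opOf (inclTensor E (HSum L)) (diagIncl F L) (wStarLamMat L A)

variable (E) in
/-- The bounded operator `ρ(B) v : ⊕ⱼ (Eⱼ ⊗ Kⱼ) → E ⊗ L`. -/
def rhoV (B : Mat K L) : DSum E K →L[ℂ] HT (HSum E) (HSum L) :=
  opOf (diagIncl E K) (tensorIncl L (HSum E)) (rhoVMat E B)

/-- The bounded operator `⊕ⱼ (Eⱼ ⊗ Kⱼ) → ⊕ᵢ (Fᵢ ⊗ Lᵢ)` with matrix `A ⊠ B`. -/
def boxOp (A : Mat E F) (B : Mat K L) : DSum E K →L[ℂ] DSum F L :=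
  opOf (diagIncl E K) (diagIncl F L) (boxtimes A B)

end Norms

/-- The block matrix of a bounded operator on a Hilbert sum `⊕ᵢ Xᵢ`. -/
def matrixOf {ι : Type*} {X : ι → Type*} [∀ i, NormedAddCommGroup (X i)]
    [∀ i, InnerProductSpace ℂ (X i)] [∀ i, CompleteSpace (X i)] (T : HSum X →L[ℂ] HSum X) :
    Mat X X :=
  blocks (incl X) (incl X) T

end

end BlockSchur

open BlockSchur

/-! The operators $\rho(B)v$ and $w^*\lambda(A)$ are built from columns, without assuming that $A$
or $B$ is bounded as a matrix. Let $b_j:K_j\to L$ be the $j$th column of $B$ and $\iota_j:E_j\to E$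
the inclusion. The operators $\iota_j\otimes b_j$ have pairwise orthogonal ranges because the
$\iota_j$ do, and norms at most $\|B\|_c$. They therefore glue to an operator $R$ with
$\|R\|\le\|B\|_c$ (`exists_of_orthogonal`, `exists_tensor_columns`). Likewise the columns
$a_i:F_i\to E$ of $A^*$ give $S$ with $\|S\|\le\|A\|_r$ and restrictions $a_i\otimes\iota_i$, where
now $\iota_i:L_i\to L$. Comparing blocks, $R=\rho(B)v$ and $S^*=w^*\lambda(A)$, and $S^*R$ has
entries $a_i^*\iota_j\otimes\iota_i^*b_j=A_{ij}\otimes B_{ij}$. This gives (i).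

For (ii), Cauchy-Schwarz bounds $\langle S^*R\,\Xi,\Gamma\rangle=\langle R\,\Xi,S\Gamma\rangle$ by
$\|R\,\Xi\|\,\|S\Gamma\|$. These norms are the ones required because
$R^*R=v^*(I\otimes\mathrm{diag}(B^*B))v$, and similarly for $S$ (`norm_apply_eq_norm_tmap_diagEmb`).
The final equality holds because the square root of a block diagonal operator is block diagonal
(`sqrt_comp_incl`), so its tensor product with $I$ maps the range of $w$ or $v$ into itself and
compression loses no norm (`norm_boxOp_matrixOf_apply`). -/

namespace BlockSchur

/-! ### Operators on a Hilbert sum glued from the summands -/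

section Glue

variable {ι : Type*} {G : ι → Type*} [∀ i, NormedAddCommGroup (G i)]
  [∀ i, InnerProductSpace ℂ (G i)]
  {V : Type*} [NormedAddCommGroup V] [InnerProductSpace ℂ V] [CompleteSpace V]
  {W : Type*} [NormedAddCommGroup W] [InnerProductSpace ℂ W]

/-- Bounded operators on a Hilbert sum are determined by their restrictions to the summands. -/
theorem hilbertSum_ext {U : ∀ i, G i →ₗᵢ[ℂ] V} (hU : IsHilbertSum ℂ G U) {S T : V →L[ℂ] W}
    (h : ∀ i, S ∘L (U i).toContinuousLinearMap = T ∘L (U i).toContinuousLinearMap) : S = T := by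
  ext x
  obtain ⟨f, rfl⟩ := hU.surjective_isometry x
  have hs := hU.OrthogonalFamily.hasSum_linearIsometry f
  refine (hs.mapL S).unique ?_
  convert! hs.mapL T using 2 with i
  exact congrArg (fun R => R (f i)) (h i)

/-- Uniformly bounded operators on the summands of a Hilbert sum, with pairwise orthogonal ranges,
are the restrictions of a bounded operator on the sum. -/
theorem exists_of_orthogonal [CompleteSpace W] {U : ∀ i, G i →ₗᵢ[ℂ] V} (hU : IsHilbertSum ℂ G U)
    (T : ∀ i, G i →L[ℂ] W) {C : ℝ} (hC : 0 ≤ C) (hTC : ∀ i, ‖T i‖ ≤ C)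
    (hT : ∀ i k, i ≠ k → ∀ x y, ⟪T i x, T k y⟫_ℂ = 0) :
    ∃ S : V →L[ℂ] W, (∀ i, S ∘L (U i).toContinuousLinearMap = T i) ∧ ‖S‖ ≤ C := by
  classical
  -- Each `T i` is factored through its range. The ranges form an orthogonal family, so their
  -- Hilbert sum embeds isometrically in `W`, and the norm of the glued operator is that of the
  -- diagonal operator `D`.
  have ho : OrthogonalFamily ℂ (fun i => LinearMap.range (T i).toLinearMap)
      fun i => (LinearMap.range (T i).toLinearMap).subtypeₗᵢ := by
    rintro i k hik ⟨_, x, rfl⟩ ⟨_, y, rfl⟩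
    exact hT i k hik x y
  let D := lp.mapCLM (𝕜 := ℂ) 2 (fun i => (T i).rangeRestrict) hC fun i =>
    ContinuousLinearMap.opNorm_le_bound _ hC fun x => (T i).le_of_opNorm_le (hTC i) x
  have hD : ‖D‖ ≤ C := LinearMap.mkContinuous_norm_le _ hC _
  refine ⟨ho.linearIsometry.toContinuousLinearMap ∘L D ∘L
    hU.linearIsometryEquiv.toLinearIsometry.toContinuousLinearMap, fun i => ?_, ?_⟩
  · ext x
    have h1 : hU.linearIsometryEquiv (U i x) = lp.single 2 i x := by
      rw [← hU.linearIsometryEquiv_symm_apply_single, LinearIsometryEquiv.apply_symm_apply]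
    have h2 : D (lp.single 2 i x) = lp.single 2 i ((T i).rangeRestrict x) := by
      refine lp.ext (funext fun k => ?_)
      change (T k).rangeRestrict (lp.single 2 i x k) = _
      by_cases hk : k = i
      · subst hk
        rw [lp.single_apply_self, lp.single_apply_self]
      · rw [lp.single_apply_ne 2 _ _ hk, lp.single_apply_ne 2 _ _ hk, map_zero]
    change ho.linearIsometry (D (hU.linearIsometryEquiv (U i x))) = _
    rw [h1, h2, ho.linearIsometry_apply_single]
    rfl
  · refine ContinuousLinearMap.opNorm_le_bound _ hC fun x => ?_
    change ‖ho.linearIsometry (D (hU.linearIsometryEquiv x))‖ ≤ _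
    rw [LinearIsometry.norm_map, ← hU.linearIsometryEquiv.norm_map x]
    exact D.le_of_opNorm_le hD _

end Glue

/-! ### Norm of a tensor product of operators -/

section TensorNorm

variable {X X' Y Y' : Type*}
  [NormedAddCommGroup X] [InnerProductSpace ℂ X] [NormedAddCommGroup X'] [InnerProductSpace ℂ X']
  [NormedAddCommGroup Y] [InnerProductSpace ℂ Y] [NormedAddCommGroup Y'] [InnerProductSpace ℂ Y']

theorem norm_tmap_le (S : X →L[ℂ] X') (T : Y →L[ℂ] Y') : ‖tmap S T‖ ≤ ‖S‖ * ‖T‖ := by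
  refine ContinuousLinearMap.opNorm_le_bound _ (by positivity) fun z => ?_
  induction z using HT.denseRange_of.induction_on with
  | hp =>
    exact isClosed_le (tmap S T).continuous.norm (continuous_const.mul continuous_norm)
  | ih z =>
    rw [tmap_of, LinearIsometry.norm_map, LinearIsometry.norm_map, ← TensorProduct.mapL_apply]
    exact (TensorProduct.mapL S T).le_of_opNorm_le (TensorProduct.norm_mapL_le S T) z

end TensorNorm

/-! ### Operators determined by their block matrices -/

section Matrix

variable {I J : Type*} {E : J → Type*} {F : I → Type*}
  [∀ j, NormedAddCommGroup (E j)] [∀ j, InnerProductSpace ℂ (E j)]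
  [∀ i, NormedAddCommGroup (F i)] [∀ i, InnerProductSpace ℂ (F i)] [∀ i, CompleteSpace (F i)]
  {X Y : Type*} [NormedAddCommGroup X] [InnerProductSpace ℂ X]
  [NormedAddCommGroup Y] [InnerProductSpace ℂ Y] [CompleteSpace Y]

theorem IsMatrixOf.isMatrixOf_opOf {U : ∀ j, E j →ₗᵢ[ℂ] X} {V : ∀ i, F i →ₗᵢ[ℂ] Y}
    {M : Mat E F} {T : X →L[ℂ] Y} (h : IsMatrixOf U V M T) : IsMatrixOf U V M (opOf U V M) := by
  have h' : ∃ T, IsMatrixOf U V M T := ⟨T, h⟩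
  rw [opOf, dif_pos h']
  exact h'.choose_spec

/-- Exhibiting one bounded operator with matrix `M` rules out the default value `0` of `opOf`;
uniqueness on Hilbert sums then identifies the chosen operator with the exhibited one. -/
theorem IsMatrixOf.opOf_eq [CompleteSpace X] {U : ∀ j, E j →ₗᵢ[ℂ] X} {V : ∀ i, F i →ₗᵢ[ℂ] Y}
    (hU : IsHilbertSum ℂ E U) (hV : IsHilbertSum ℂ F V)
    {M : Mat E F} {T : X →L[ℂ] Y} (h : IsMatrixOf U V M T) : opOf U V M = T :=
  isMatrixOf_unique hU hV h.isMatrixOf_opOf h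

end Matrix

/-! ### Compressions to the diagonal subspace and block diagonal operators -/

section Decomp

variable {ι : Type*} (X Y : ι → Type*)
  [∀ i, NormedAddCommGroup (X i)] [∀ i, InnerProductSpace ℂ (X i)] [∀ i, CompleteSpace (X i)]
  [∀ i, NormedAddCommGroup (Y i)] [∀ i, InnerProductSpace ℂ (Y i)] [∀ i, CompleteSpace (Y i)]

theorem inner_eq_zero_of_adjoint_comp_eq_zero {G G' V : Type*} [NormedAddCommGroup G]
    [InnerProductSpace ℂ G] [CompleteSpace G] [NormedAddCommGroup G'] [InnerProductSpace ℂ G']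
    [NormedAddCommGroup V] [InnerProductSpace ℂ V] [CompleteSpace V]
    {S : G →L[ℂ] V} {T : G' →L[ℂ] V} (h : S.adjoint ∘L T = 0) (x : G) (y : G') :
    ⟪S x, T y⟫_ℂ = 0 := by
  rw [← ContinuousLinearMap.adjoint_inner_right, ← ContinuousLinearMap.comp_apply, h]
  simp

omit [∀ i, CompleteSpace (X i)] [∀ i, CompleteSpace (Y i)] in
theorem diagEmb_comp_diagIncl (i : ι) :
    (diagEmb X Y).toContinuousLinearMap ∘L (diagIncl X Y i).toContinuousLinearMap
      = tmap (incl X i).toContinuousLinearMap (incl Y i).toContinuousLinearMap := rfl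

theorem diagIncl_adjoint_comp_diagEmb_adjoint (i : ι) :
    (diagIncl X Y i).toContinuousLinearMap.adjoint ∘L (diagEmb X Y).toContinuousLinearMap.adjoint
      = tmap (incl X i).toContinuousLinearMap.adjoint
          (incl Y i).toContinuousLinearMap.adjoint := by
  rw [← ContinuousLinearMap.adjoint_comp, diagEmb_comp_diagIncl, tmap_adjoint]

variable {X Y}

/-- `w* (P ⊗ Q) w` has the matrix `P ⊠ Q`. -/
theorem isMatrixOf_compression (P : HSum X →L[ℂ] HSum X) (Q : HSum Y →L[ℂ] HSum Y) :
    IsMatrixOf (diagIncl X Y) (diagIncl X Y) (boxtimes (matrixOf P) (matrixOf Q))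
      ((diagEmb X Y).toContinuousLinearMap.adjoint ∘L tmap P Q ∘L
        (diagEmb X Y).toContinuousLinearMap) := by
  funext i k
  calc _ = ((diagIncl X Y i).toContinuousLinearMap.adjoint ∘L
        (diagEmb X Y).toContinuousLinearMap.adjoint) ∘L tmap P Q ∘L
        ((diagEmb X Y).toContinuousLinearMap ∘L (diagIncl X Y k).toContinuousLinearMap) := rfl
    _ = _ := by
      rw [diagIncl_adjoint_comp_diagEmb_adjoint, diagEmb_comp_diagIncl, tmap_comp, tmap_comp]
      rfl

theorem boxOp_matrixOf (P : HSum X →L[ℂ] HSum X) (Q : HSum Y →L[ℂ] HSum Y) :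
    boxOp (matrixOf P) (matrixOf Q) = (diagEmb X Y).toContinuousLinearMap.adjoint ∘L tmap P Q ∘L
        (diagEmb X Y).toContinuousLinearMap :=
  (isMatrixOf_compression P Q).opOf_eq (isHilbertSum_diagIncl X Y) (isHilbertSum_diagIncl X Y)

/-- Block diagonal `P` and `Q` make `P ⊗ Q` preserve each `Xᵢ ⊗ Yᵢ`, hence the range of the
embedding. For general `P` and `Q` the compression could decrease the norm. -/
theorem norm_boxOp_matrixOf_apply {P : HSum X →L[ℂ] HSum X} {Q : HSum Y →L[ℂ] HSum Y}
    {p : ∀ i, X i →L[ℂ] X i} {q : ∀ i, Y i →L[ℂ] Y i}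
    (hP : ∀ i, P ∘L (incl X i).toContinuousLinearMap = (incl X i).toContinuousLinearMap ∘L p i)
    (hQ : ∀ i, Q ∘L (incl Y i).toContinuousLinearMap = (incl Y i).toContinuousLinearMap ∘L q i)
    (z : DSum X Y) :
    ‖boxOp (matrixOf P) (matrixOf Q) z‖ = ‖tmap P Q (diagEmb X Y z)‖ := by
  set w := (diagEmb X Y).toContinuousLinearMap with hw
  have hww : w.adjoint ∘L w = .id ℂ _ := by
    ext z
    refine ext_inner_left ℂ fun x => ?_
    rw [ContinuousLinearMap.comp_apply, ContinuousLinearMap.adjoint_inner_right]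
    exact (diagEmb X Y).inner_map_map _ _
  -- This is `w w* (P ⊗ Q) w = (P ⊗ Q) w`; on each summand the image already lies in the range of
  -- `w`, where `w w*` is the identity.
  have key : w ∘L boxOp (matrixOf P) (matrixOf Q) = tmap P Q ∘L w := by
    refine hilbertSum_ext (isHilbertSum_diagIncl X Y) fun i => ?_
    have e : (tmap P Q ∘L w) ∘L (diagIncl X Y i).toContinuousLinearMap
        = w ∘L (diagIncl X Y i).toContinuousLinearMap ∘L tmap (p i) (q i) := by
      rw [ContinuousLinearMap.comp_assoc, ← ContinuousLinearMap.comp_assoc w,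
        diagEmb_comp_diagIncl, tmap_comp, tmap_comp, hP, hQ]
    rw [e, boxOp_matrixOf, ContinuousLinearMap.comp_assoc, ContinuousLinearMap.comp_assoc, e,
      ← ContinuousLinearMap.comp_assoc _ w, hww]
    rfl
  rw [← (diagEmb X Y).norm_map]
  exact congrArg (fun R => ‖R z‖) key

/-- If the restrictions of `R` to the summands are `c i ⊗ d i`, with orthogonal ranges, and if
`P* P` and `Q* Q` are diagonal with entries `c i* c i` and `d i* d i`, then
`‖R z‖ = ‖(P ⊗ Q) w z‖` for the embedding `w`. -/
theorem norm_apply_eq_norm_tmap_diagEmb {V W : Type*} [NormedAddCommGroup V]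
    [InnerProductSpace ℂ V] [CompleteSpace V] [NormedAddCommGroup W] [InnerProductSpace ℂ W]
    [CompleteSpace W] {R : DSum X Y →L[ℂ] HT V W} {c : ∀ i, X i →L[ℂ] V} {d : ∀ i, Y i →L[ℂ] W}
    (hR : ∀ i, R ∘L (diagIncl X Y i).toContinuousLinearMap = tmap (c i) (d i))
    (hcd : ∀ i k, i ≠ k → tmap ((c i).adjoint ∘L c k) ((d i).adjoint ∘L d k) = 0)
    {P : HSum X →L[ℂ] HSum X} {Q : HSum Y →L[ℂ] HSum Y}
    (hP : ∀ i, (P.adjoint ∘L P) ∘L (incl X i).toContinuousLinearMap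
      = (incl X i).toContinuousLinearMap ∘L ((c i).adjoint ∘L c i))
    (hQ : ∀ i, (Q.adjoint ∘L Q) ∘L (incl Y i).toContinuousLinearMap
      = (incl Y i).toContinuousLinearMap ∘L ((d i).adjoint ∘L d i))
    (z : DSum X Y) : ‖R z‖ = ‖tmap P Q (diagEmb X Y z)‖ := by
  -- Both norms are determined by `T* T`, and the two bounded operators `T* T` can be compared block
  -- by block: the diagonal blocks agree by `hP` and `hQ`, and the others vanish on both sides.
  have key : R.adjoint ∘L R = (tmap P Q ∘L (diagEmb X Y).toContinuousLinearMap).adjoint ∘L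
      (tmap P Q ∘L (diagEmb X Y).toContinuousLinearMap) := by
    refine isMatrixOf_unique (isHilbertSum_diagIncl X Y) (isHilbertSum_diagIncl X Y) rfl ?_
    rw [ContinuousLinearMap.adjoint_comp, ContinuousLinearMap.comp_assoc,
      ← ContinuousLinearMap.comp_assoc _ (tmap P Q), tmap_adjoint, tmap_comp]
    refine (isMatrixOf_compression _ _).trans ?_
    funext i k
    calc _ = tmap (((incl X i).toContinuousLinearMap.adjoint ∘L
            (incl X k).toContinuousLinearMap) ∘L ((c k).adjoint ∘L c k))
          (((incl Y i).toContinuousLinearMap.adjoint ∘L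
            (incl Y k).toContinuousLinearMap) ∘L ((d k).adjoint ∘L d k)) := by
          rw [boxtimes, matrixOf, matrixOf, blocks, blocks, hP, hQ]; rfl
      _ = tmap ((c i).adjoint ∘L c k) ((d i).adjoint ∘L d k) := by
          by_cases hik : i = k
          · subst hik
            rw [incl_adjoint_incl_self, incl_adjoint_incl_self]; rfl
          · rw [incl_adjoint_incl_ne _ hik, hcd i k hik, ContinuousLinearMap.zero_comp,
              tmap_zero_left]
      _ = (R ∘L (diagIncl X Y i).toContinuousLinearMap).adjoint ∘L
          (R ∘L (diagIncl X Y k).toContinuousLinearMap) := by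
          rw [hR, hR, tmap_adjoint, tmap_comp]
      _ = _ := by rw [ContinuousLinearMap.adjoint_comp]; rfl
  have h : ‖R z‖ ^ 2 = ‖tmap P Q (diagEmb X Y z)‖ ^ 2 := by
    rw [ContinuousLinearMap.apply_norm_sq_eq_inner_adjoint_left, key,
      ← ContinuousLinearMap.apply_norm_sq_eq_inner_adjoint_left]
    rfl
  exact (pow_left_inj₀ (norm_nonneg _) (norm_nonneg _) two_ne_zero).mp h

/-- The square root of a selfadjoint block diagonal operator is block diagonal. -/
theorem sqrt_comp_incl {D : HSum X →L[ℂ] HSum X} (hD : IsSelfAdjoint D) {d : ∀ i, X i →L[ℂ] X i}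
    (h : ∀ i, D ∘L (incl X i).toContinuousLinearMap = (incl X i).toContinuousLinearMap ∘L d i)
    (i : ι) :
    CFC.sqrt D ∘L (incl X i).toContinuousLinearMap
      = (incl X i).toContinuousLinearMap ∘L matrixOf (CFC.sqrt D) i i := by
  set u := (incl X i).toContinuousLinearMap with hu
  -- `p` is the orthogonal projection onto the `i`th summand. Invariance of the summand gives `p D p
  -- = D p`, and adjoints give `p D p = p D` since `D` is selfadjoint. Thus `p` commutes with `D`,
  -- hence with its square root by the functional calculus.
  set p : HSum X →L[ℂ] HSum X := u ∘L u.adjoint with hp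
  have hps : star p = p := by
    rw [ContinuousLinearMap.star_eq_adjoint, hp, ContinuousLinearMap.adjoint_comp,
      ContinuousLinearMap.adjoint_adjoint]
  have hpu : p ∘L u = u := by
    rw [hp, ContinuousLinearMap.comp_assoc, incl_adjoint_incl_self]; rfl
  have h1 : p * (D * p) = D * p := by
    have e : D * p = u ∘L (d i ∘L u.adjoint) := congrArg (fun R => R ∘L u.adjoint) (h i)
    rw [e]
    exact congrArg (fun R => R ∘L (d i ∘L u.adjoint)) hpu
  have h2 : p * D * p = p * D := by
    have := congrArg star h1
    simpa only [star_mul, hps, hD.star_eq] using this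
  have hc : Commute D p := by
    change D * p = p * D
    rw [← h2, ← h1, mul_assoc]
  have hc' : Commute (CFC.sqrt D) p := Commute.cfcₙ_nnreal hc _
  calc CFC.sqrt D ∘L u = (CFC.sqrt D * p) ∘L u := by
        conv_lhs => rw [← hpu]
        rfl
    _ = (p * CFC.sqrt D) ∘L u := by rw [hc'.eq]
    _ = _ := rfl

end Decomp

/-! ### Glued columns, their matrices and the diagonal operators -/

section Norms

variable {I J : Type*} {E K : J → Type*} {F L : I → Type*}
  [∀ j, NormedAddCommGroup (E j)] [∀ j, InnerProductSpace ℂ (E j)] [∀ j, CompleteSpace (E j)]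
  [∀ i, NormedAddCommGroup (F i)] [∀ i, InnerProductSpace ℂ (F i)] [∀ i, CompleteSpace (F i)]
  [∀ j, NormedAddCommGroup (K j)] [∀ j, InnerProductSpace ℂ (K j)] [∀ j, CompleteSpace (K j)]
  [∀ i, NormedAddCommGroup (L i)] [∀ i, InnerProductSpace ℂ (L i)] [∀ i, CompleteSpace (L i)]

theorem colNorm_nonneg (B : Mat K L) : 0 ≤ colNorm B := Real.sqrt_nonneg _

theorem colNorm_adjMat (A : Mat E F) : colNorm (adjMat A) = rowNorm A := by
  have : colPart (adjMat A) = rowPart A := by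
    ext p
    simp [colPart, rowPart, adjMat]
  rw [colNorm, rowNorm, this]

theorem colOp_adjoint_comp_incl (B : Mat K L) (hB : ColBounded B) (j : J) (i : I) :
    (colOp B hB j).adjoint ∘L (incl L i).toContinuousLinearMap = (B i j).adjoint := by
  rw [← incl_adjoint_colOp B hB, ContinuousLinearMap.adjoint_comp,
    ContinuousLinearMap.adjoint_adjoint]

theorem diagColOp_comp_incl (B : Mat K L) (hB : ColBounded B) (j : J) :
    diagColOp B hB ∘L (incl K j).toContinuousLinearMap
      = (incl K j).toContinuousLinearMap ∘L colDiag B hB j := by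
  ext x
  refine lp.ext (funext fun k => ?_)
  rw [← incl_adjoint, ← incl_adjoint]
  by_cases hk : k = j
  · subst hk
    have h1 := congrArg (fun R => R x) (incl_adjoint_incl_self K k)
    have h2 := congrArg (fun R => R (colDiag B hB k x)) (incl_adjoint_incl_self K k)
    refine Eq.trans ?_ h2.symm
    rw [incl_adjoint]
    -- `diagColOp` acts coordinatewise by definition; `incl_adjoint` passes between coordinates and
    -- adjoints of inclusions.
    change colDiag B hB k ((show lp K 2 from incl K k x) k) = _
    rw [← incl_adjoint]
    exact congrArg _ h1
  · have h1 := congrArg (fun R => R x) (incl_adjoint_incl_ne K hk)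
    have h2 := congrArg (fun R => R (colDiag B hB j x)) (incl_adjoint_incl_ne K hk)
    refine Eq.trans ?_ h2.symm
    rw [incl_adjoint]
    change colDiag B hB k ((show lp K 2 from incl K j x) k) = _
    rw [← incl_adjoint]
    exact (congrArg _ h1).trans (map_zero _)

theorem norm_incl_le {ι : Type*} {X : ι → Type*} [∀ i, NormedAddCommGroup (X i)]
    [∀ i, InnerProductSpace ℂ (X i)] (i : ι) : ‖(incl X i).toContinuousLinearMap‖ ≤ 1 :=
  (incl X i).norm_toContinuousLinearMap_le

/-- Placing the columns of `B` in pairwise orthogonal copies of `⊕ᵢ Lᵢ`, one for each `j`, yields a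
bounded `C` with `C* C = diag(B*B)`: the separate copies remove the off-diagonal blocks. Positivity
ensures that `CFC.sqrt` squares back to the operator. -/
theorem diagColOp_nonneg (B : Mat K L) (hB : ColBounded B) : 0 ≤ diagColOp B hB := by
  obtain ⟨C, hC, -⟩ := exists_of_orthogonal (isHilbertSum_incl K)
    (fun j => (incl (fun _ : J => HSum L) j).toContinuousLinearMap ∘L colOp B hB j)
    (colNorm_nonneg B)
    (fun j => ContinuousLinearMap.opNorm_le_bound _ (colNorm_nonneg B) fun x => by
      rw [ContinuousLinearMap.comp_apply]
      exact ((incl (fun _ : J => HSum L) j).norm_map _).trans_le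
        ((colOp B hB j).le_of_opNorm_le (norm_colOp_le B hB j) x))
    fun i k hik x y => (isHilbertSum_incl fun _ : J => HSum L).OrthogonalFamily hik _ _
  have key : diagColOp B hB = C.adjoint ∘L C := by
    refine isMatrixOf_unique (isHilbertSum_incl K) (isHilbertSum_incl K) rfl ?_
    funext i k
    calc _ = (C ∘L (incl K i).toContinuousLinearMap).adjoint ∘L
          (C ∘L (incl K k).toContinuousLinearMap) := by
          rw [ContinuousLinearMap.adjoint_comp]; rfl
      _ = (colOp B hB i).adjoint ∘L
          ((incl (fun _ : J => HSum L) i).toContinuousLinearMap.adjoint ∘L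
            (incl (fun _ : J => HSum L) k).toContinuousLinearMap) ∘L colOp B hB k := by
          rw [hC, hC, ContinuousLinearMap.adjoint_comp]; rfl
      _ = ((incl K i).toContinuousLinearMap.adjoint ∘L (incl K k).toContinuousLinearMap) ∘L
          colDiag B hB k := by
          by_cases hik : i = k
          · subst hik
            rw [incl_adjoint_incl_self, incl_adjoint_incl_self fun _ : J => HSum L]; rfl
          · rw [incl_adjoint_incl_ne _ hik, incl_adjoint_incl_ne (fun _ : J => HSum L) hik,
              ContinuousLinearMap.zero_comp, ContinuousLinearMap.zero_comp,
              ContinuousLinearMap.comp_zero]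
      _ = _ := by rw [blocks, diagColOp_comp_incl]; rfl
  rw [key, ContinuousLinearMap.nonneg_iff_isPositive]
  exact C.isPositive_adjoint_comp_self

variable (E) in
/-- The columns of a column bounded matrix, tensored with the identity of `Eⱼ`, glue to a bounded
operator on `⊕ⱼ (Eⱼ ⊗ Kⱼ)`. -/
theorem exists_tensor_columns (B : Mat K L) (hB : ColBounded B) :
    ∃ R : DSum E K →L[ℂ] HT (HSum E) (HSum L),
      (∀ j, R ∘L (diagIncl E K j).toContinuousLinearMap
        = tmap (incl E j).toContinuousLinearMap (colOp B hB j)) ∧ ‖R‖ ≤ colNorm B := by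
  refine exists_of_orthogonal (isHilbertSum_diagIncl E K) _ (colNorm_nonneg B) (fun j => ?_)
    fun i k hik => inner_eq_zero_of_adjoint_comp_eq_zero ?_
  · refine (norm_tmap_le _ _).trans ?_
    calc _ ≤ 1 * colNorm B := mul_le_mul (norm_incl_le j) (norm_colOp_le B hB j)
          (norm_nonneg _) zero_le_one
      _ = _ := one_mul _
  -- Orthogonality comes from the inclusions in the first factor alone; the columns of `B` need not
  -- be orthogonal.
  · rw [tmap_adjoint, tmap_comp, incl_adjoint_incl_ne E hik, tmap_zero_left]

variable (E) in
-- The version with the factors exchanged. Applied to `A*`, it yields the adjoint of `w* λ(A)`.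
theorem exists_columns_tensor (B : Mat K L) (hB : ColBounded B) :
    ∃ R : DSum K E →L[ℂ] HT (HSum L) (HSum E),
      (∀ j, R ∘L (diagIncl K E j).toContinuousLinearMap
        = tmap (colOp B hB j) (incl E j).toContinuousLinearMap) ∧ ‖R‖ ≤ colNorm B := by
  refine exists_of_orthogonal (isHilbertSum_diagIncl K E) _ (colNorm_nonneg B) (fun j => ?_)
    fun i k hik => inner_eq_zero_of_adjoint_comp_eq_zero ?_
  · refine (norm_tmap_le _ _).trans ?_
    calc _ ≤ colNorm B * 1 := mul_le_mul (norm_colOp_le B hB j) (norm_incl_le j)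
          (norm_nonneg _) (colNorm_nonneg B)
      _ = _ := mul_one _
  · rw [tmap_adjoint, tmap_comp, incl_adjoint_incl_ne E hik, tmap_zero_right]

/-- The `j`th diagonal block of `v` is `incl E j ⊗ I`, so both matrices have the entries `incl E j ⊗
Bᵢⱼ`. -/
theorem isMatrixOf_rhoVMat {B : Mat K L} {hB : ColBounded B}
    {R : DSum E K →L[ℂ] HT (HSum E) (HSum L)}
    (hR : ∀ j, R ∘L (diagIncl E K j).toContinuousLinearMap
        = tmap (incl E j).toContinuousLinearMap (colOp B hB j)) :
    IsMatrixOf (diagIncl E K) (tensorIncl L (HSum E)) (rhoVMat E B) R := by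
  funext i j
  rw [blocks, hR, rhoVMat, rho, blocks, diagEmb_comp_diagIncl, tensorIncl, tensorIncl,
    tmapIso_toCLM, tmapIso_toCLM, tmap_adjoint, tmap_adjoint, tmap_comp, tmap_comp, tmap_comp,
    incl_adjoint_colOp, incl_adjoint_incl_self]
  rfl

/-- The `i`th column of `A*` has adjoint with `j`th block `Aᵢⱼ`, and the `i`th diagonal block of
`w*` is `I ⊗ (incl L i)*`; both matrices have the entries `Aᵢⱼ ⊗ (incl L i)*`. -/
theorem isMatrixOf_wStarLamMat {A : Mat E F} {hA : ColBounded (adjMat A)}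
    {S : DSum F L →L[ℂ] HT (HSum E) (HSum L)}
    (hS : ∀ i, S ∘L (diagIncl F L i).toContinuousLinearMap
        = tmap (colOp (adjMat A) hA i) (incl L i).toContinuousLinearMap) :
    IsMatrixOf (inclTensor E (HSum L)) (diagIncl F L) (wStarLamMat L A) S.adjoint := by
  funext i j
  rw [blocks, ← ContinuousLinearMap.comp_assoc, ← ContinuousLinearMap.adjoint_comp, hS,
    wStarLamMat, lam, blocks, ← ContinuousLinearMap.comp_assoc,
    diagIncl_adjoint_comp_diagEmb_adjoint, inclTensor, inclTensor,
    tmapIso_toCLM, tmapIso_toCLM, tmap_adjoint, tmap_comp, tmap_comp, tmap_comp,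
    incl_adjoint_incl_self]
  rw [colOp_adjoint_comp_incl, adjMat, ContinuousLinearMap.adjoint_adjoint]
  rfl

theorem isMatrixOf_boxtimes {A : Mat E F} {hA : ColBounded (adjMat A)} {B : Mat K L}
    {hB : ColBounded B} {R : DSum E K →L[ℂ] HT (HSum E) (HSum L)}
    (hR : ∀ j, R ∘L (diagIncl E K j).toContinuousLinearMap
        = tmap (incl E j).toContinuousLinearMap (colOp B hB j))
    {S : DSum F L →L[ℂ] HT (HSum E) (HSum L)}
    (hS : ∀ i, S ∘L (diagIncl F L i).toContinuousLinearMap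
        = tmap (colOp (adjMat A) hA i) (incl L i).toContinuousLinearMap) :
    IsMatrixOf (diagIncl E K) (diagIncl F L) (boxtimes A B) (S.adjoint ∘L R) := by
  funext i j
  calc _ = (S ∘L (diagIncl F L i).toContinuousLinearMap).adjoint ∘L
        (R ∘L (diagIncl E K j).toContinuousLinearMap) := by
        rw [ContinuousLinearMap.adjoint_comp]; rfl
    _ = _ := by
      rw [hS, hR, tmap_adjoint, tmap_comp, colOp_adjoint_comp_incl, incl_adjoint_colOp,
        adjMat, ContinuousLinearMap.adjoint_adjoint]
      rfl

theorem sqrt_diagColOp_adjoint_comp_self (B : Mat K L) (hB : ColBounded B) :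
    (CFC.sqrt (diagColOp B hB)).adjoint ∘L CFC.sqrt (diagColOp B hB) = diagColOp B hB := by
  rw [← ContinuousLinearMap.star_eq_adjoint, (CFC.sqrt_nonneg _).isSelfAdjoint.star_eq]
  exact CFC.sqrt_mul_sqrt_self _ (diagColOp_nonneg B hB)

/-- Supplies the diagonality hypothesis of `norm_apply_eq_norm_tmap_diagEmb` for the tensor factor
in which the columns are mere inclusions. -/
theorem id_adjoint_comp_id_comp_incl {ι : Type*} (X : ι → Type*) [∀ i, NormedAddCommGroup (X i)]
    [∀ i, InnerProductSpace ℂ (X i)] [∀ i, CompleteSpace (X i)] (i : ι) :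
    ((ContinuousLinearMap.id ℂ (HSum X)).adjoint ∘L .id ℂ (HSum X)) ∘L
        (incl X i).toContinuousLinearMap
      = (incl X i).toContinuousLinearMap ∘L
        ((incl X i).toContinuousLinearMap.adjoint ∘L (incl X i).toContinuousLinearMap) := by
  rw [incl_adjoint_incl_self, ContinuousLinearMap.adjoint_id]
  rfl

end Norms

end BlockSchur

/-! ### The factorization and the inequalities -/

theorem theorem4p2 {I J : Type*} {E K : J → Type*} {F L : I → Type*}
    [∀ j, NormedAddCommGroup (E j)] [∀ j, InnerProductSpace ℂ (E j)] [∀ j, CompleteSpace (E j)]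
    [∀ j, NormedAddCommGroup (K j)] [∀ j, InnerProductSpace ℂ (K j)] [∀ j, CompleteSpace (K j)]
    [∀ i, NormedAddCommGroup (F i)] [∀ i, InnerProductSpace ℂ (F i)] [∀ i, CompleteSpace (F i)]
    [∀ i, NormedAddCommGroup (L i)] [∀ i, InnerProductSpace ℂ (L i)] [∀ i, CompleteSpace (L i)]
    (A : Mat E F) (hA : RowBounded A) (B : Mat K L) (hB : ColBounded B) :
    -- `w* λ(A)` and `ρ(B) v` are bounded operators
    IsMatrixOf (inclTensor E (HSum L)) (diagIncl F L) (wStarLamMat L A) (wStarLam L A) ∧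
    IsMatrixOf (diagIncl E K) (tensorIncl L (HSum E)) (rhoVMat E B) (rhoV E B) ∧
    -- `A ⊠ B` is the matrix of their product
    IsMatrixOf (diagIncl E K) (diagIncl F L) (boxtimes A B) (wStarLam L A ∘L rhoV E B) ∧
    boxOp A B = wStarLam L A ∘L rhoV E B ∧
    -- (i)
    ‖boxOp A B‖ ≤ rowNorm A * colNorm B ∧
    -- (ii), where both matrices on the right are matrices of bounded operators
    IsMatrixOf (diagIncl F L) (diagIncl F L)
      (boxtimes (matrixOf (CFC.sqrt (diagRowOp A hA))) (matrixOf (.id ℂ (HSum L))))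
      (boxOp (matrixOf (CFC.sqrt (diagRowOp A hA))) (matrixOf (.id ℂ (HSum L)))) ∧
    IsMatrixOf (diagIncl E K) (diagIncl E K)
      (boxtimes (matrixOf (.id ℂ (HSum E))) (matrixOf (CFC.sqrt (diagColOp B hB))))
      (boxOp (matrixOf (.id ℂ (HSum E))) (matrixOf (CFC.sqrt (diagColOp B hB)))) ∧
    ∀ (Ξ : DSum E K) (Γ : DSum F L),
      ‖inner ℂ (boxOp A B Ξ) Γ‖ ≤
        ‖boxOp (matrixOf (CFC.sqrt (diagRowOp A hA))) (matrixOf (.id ℂ (HSum L))) Γ‖ *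
          ‖boxOp (matrixOf (.id ℂ (HSum E))) (matrixOf (CFC.sqrt (diagColOp B hB))) Ξ‖ ∧
      ‖boxOp (matrixOf (CFC.sqrt (diagRowOp A hA))) (matrixOf (.id ℂ (HSum L))) Γ‖ *
          ‖boxOp (matrixOf (.id ℂ (HSum E))) (matrixOf (CFC.sqrt (diagColOp B hB))) Ξ‖ =
        ‖tmap (CFC.sqrt (diagRowOp A hA)) (.id ℂ (HSum L)) (diagEmb F L Γ)‖ *
          ‖tmap (.id ℂ (HSum E)) (CFC.sqrt (diagColOp B hB)) (diagEmb E K Ξ)‖ := by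
  have hA' := hA.colBounded_adjMat
  obtain ⟨R, hR, hRn⟩ := exists_tensor_columns E B hB
  obtain ⟨S, hS, hSn⟩ := exists_columns_tensor L (adjMat A) hA'
  rw [colNorm_adjMat] at hSn
  have hw := isMatrixOf_wStarLamMat hS
  have hr := isMatrixOf_rhoVMat hR
  have hb := isMatrixOf_boxtimes hR hS
  have ew : wStarLam L A = S.adjoint :=
    hw.opOf_eq (isHilbertSum_inclTensor E (HSum L)) (isHilbertSum_diagIncl F L)
  have er : rhoV E B = R :=
    hr.opOf_eq (isHilbertSum_diagIncl E K) (isHilbertSum_tensorIncl L (HSum E))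
  have eb : boxOp A B = S.adjoint ∘L R :=
    hb.opOf_eq (isHilbertSum_diagIncl E K) (isHilbertSum_diagIncl F L)
  rw [ew, er, eb]
  refine ⟨hw, hr, hb, rfl, ?_, (isMatrixOf_compression _ _).isMatrixOf_opOf,
    (isMatrixOf_compression _ _).isMatrixOf_opOf, fun Ξ Γ => ?_⟩
  · refine (ContinuousLinearMap.opNorm_comp_le _ _).trans ?_
    rw [LinearIsometryEquiv.norm_map]
    exact mul_le_mul hSn hRn (norm_nonneg _) (Real.sqrt_nonneg _)
  -- `e1` and `e2` compare the compressed operators with the uncompressed ones and use that the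
  -- square roots themselves are block diagonal.
  · have e1 : ‖boxOp (matrixOf (CFC.sqrt (diagRowOp A hA))) (matrixOf (.id ℂ (HSum L))) Γ‖
        = ‖tmap (CFC.sqrt (diagRowOp A hA)) (.id ℂ (HSum L)) (diagEmb F L Γ)‖ :=
      norm_boxOp_matrixOf_apply (q := fun i => .id ℂ (L i))
        (sqrt_comp_incl (diagColOp_nonneg _ hA').isSelfAdjoint (diagColOp_comp_incl _ hA'))
        (fun _ => rfl) Γ
    have e2 : ‖boxOp (matrixOf (.id ℂ (HSum E))) (matrixOf (CFC.sqrt (diagColOp B hB))) Ξ‖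
        = ‖tmap (.id ℂ (HSum E)) (CFC.sqrt (diagColOp B hB)) (diagEmb E K Ξ)‖ :=
      norm_boxOp_matrixOf_apply (p := fun j => .id ℂ (E j)) (fun _ => rfl)
        (sqrt_comp_incl (diagColOp_nonneg _ hB).isSelfAdjoint (diagColOp_comp_incl _ hB)) Ξ
    -- `e3` and `e4` use only that the squares of the roots are the diagonal operators, whose
    -- entries are `c* c` for the columns `c` glued into `S` and `R`.
    have e3 : ‖S Γ‖ = ‖tmap (CFC.sqrt (diagRowOp A hA)) (.id ℂ (HSum L)) (diagEmb F L Γ)‖ :=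
      norm_apply_eq_norm_tmap_diagEmb hS
        (fun i k hik => by rw [incl_adjoint_incl_ne L hik, tmap_zero_right])
        (fun i => by
          rw [diagRowOp, sqrt_diagColOp_adjoint_comp_self, diagColOp_comp_incl]; rfl)
        (id_adjoint_comp_id_comp_incl L) Γ
    have e4 : ‖R Ξ‖ = ‖tmap (.id ℂ (HSum E)) (CFC.sqrt (diagColOp B hB)) (diagEmb E K Ξ)‖ :=
      norm_apply_eq_norm_tmap_diagEmb hR
        (fun i k hik => by rw [incl_adjoint_incl_ne E hik, tmap_zero_left])
        (id_adjoint_comp_id_comp_incl E)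
        (fun j => by rw [sqrt_diagColOp_adjoint_comp_self, diagColOp_comp_incl]; rfl) Ξ
    rw [e1, e2, ← e3, ← e4]
    refine ⟨?_, rfl⟩
    -- What remains is the Cauchy-Schwarz inequality for `R Ξ` and `S Γ` in `E ⊗ L`.
    rw [ContinuousLinearMap.comp_apply, ContinuousLinearMap.adjoint_inner_left, mul_comm]
    exact norm_inner_le_norm _ _
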